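/- Let $\mathbb S^1=\{z\in\mathbb C:|z|=1\}$ carry arclength measure, and let $|x-y|$ denote the Euclidean (chordal) distance. For $1<p\le 2$, let $W^{1/p,p}(\mathbb S^1;\mathbb S^1)$ be the set of measurable maps $f:\mathbb S^1\to\mathbb S^1$ such that $$\int_{\mathbb S^1}\int_{\mathbb S^1}\frac{|f(x)-f(y)|^p}{|x-y|^2}\,dx\,dy<\infty .$$ For such $f$ let $\deg f\in\mathbb Z$ be its Brezis–Nirenberg (VMO) degree: with $f_\varepsilon(x)$ the mean of $f$ over the arc of length $2\varepsilon$ centred at $x$, for all sufficiently small $\varepsilon>0$ the continuous function $f_\varepsilon$ has no zero and the winding number of $f_\varepsilon/|f_\varepsilon|:\mathbb S^1\to\mathbb S^1$ is an integer independent of $\varepsilon$; this integer is $\deg f$. It agrees with the winding number of $f$ when $f$ is continuous. There exists a universal constant $c$ such that for every $1<p\le 2$ and every $f\in W^{1/p,p}(\mathbb S^1;\mathbb S^1)$ the degree $\deg f$ is well defined and $$|\deg f|\le c\,(p-1)\int_{\mathbb S^1}\int_{\mathbb S^1}\frac{|f(x)-f(y)|^p}{|x-y|^2}\,dx\,dy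 .$$ -/

import Mathlib

open MeasureTheory Filter Topology

noncomputable instance : MeasurableSpace Circle := borel Circle

instance : BorelSpace Circle := ⟨rfl⟩

/-- Arclength measure on the unit circle `{z : ℂ | ‖z‖ = 1}` (total mass `2π`): the image of Lebesgue
measure on `(-π, π]` under `t ↦ exp (i t)`. -/
noncomputable def arclength : Measure Circle :=
  Measure.map (fun t : ℝ => Circle.exp t) (volume.restrict (Set.Ioc (-Real.pi) Real.pi))

/-- `f ∈ W^{s,p}(S¹; S¹)`: `f` is measurable (up to a null set) and its Gagliardo energy
`∬ |f(x) - f(y)|^p / |x - y|^(1 + s p) dx dy` is finite. `dist` on `Circle` is the chordal distance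
inherited from `ℂ`. Membership in `L^p` is automatic, since `|f| = 1`. -/
def MemFracSobolev (s p : ℝ) (f : Circle → Circle) : Prop :=
  AEMeasurable f arclength ∧
    ∫⁻ x, ∫⁻ y, ENNReal.ofReal (dist (f x) (f y) ^ p / dist x y ^ (1 + s * p))
      ∂arclength ∂arclength < ⊤

/-- `d` is the winding number of the continuous map `g : S¹ → S¹`: there is a continuous angle
function `θ` with `g (exp (i t)) = exp (i θ(t))` and `θ(2π) - θ(0) = 2π d`. -/
def HasWindingNumber (g : Circle → Circle) (d : ℤ) : Prop :=
  ∃ θ : ℝ → ℝ, Continuous θ ∧ (∀ t : ℝ, g (Circle.exp t) = Circle.exp (θ t)) ∧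
    θ (2 * Real.pi) - θ 0 = 2 * Real.pi * d

/-- The mean of `f` over the arc with centre `x` and length `2ε` (for `0 < ε ≤ π`). -/
noncomputable def arcMean (f : Circle → Circle) (ε : ℝ) (x : Circle) : ℂ :=
  ((2 * ε)⁻¹ : ℝ) • ∫ s in (-ε)..ε, (f (x * Circle.exp s) : ℂ)

/-- `d` is the Brezis–Nirenberg (VMO) degree of `f`: for all small `ε > 0` the arc means `f_ε` do not
vanish and the continuous map `f_ε / |f_ε|` has winding number `d`. -/
def HasVMODegree (f : Circle → Circle) (d : ℤ) : Prop :=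
  ∀ᶠ ε in 𝓝[>] (0 : ℝ), ∃ g : Circle → Circle,
    (∀ x, arcMean f ε x ≠ 0 ∧ (g x : ℂ) = arcMean f ε x / (‖arcMean f ε x‖ : ℂ)) ∧
      HasWindingNumber g d

theorem HasWindingNumber.unique {g : Circle → Circle} {d e : ℤ}
    (hd : HasWindingNumber g d) (he : HasWindingNumber g e) : d = e := by
  obtain ⟨θ, hθ, hg, h1⟩ := hd
  obtain ⟨η, hη, hg', h2⟩ := he
  have key : ∀ t, ∃ m : ℤ, θ t = η t + m * (2 * Real.pi) := fun t =>
    Circle.exp_eq_exp.1 ((hg t).symm.trans (hg' t))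
  choose m hm using key
  have hpi : (0 : ℝ) < 2 * Real.pi := Real.two_pi_pos
  have hmc : Continuous m := by
    rw [Int.isClosedEmbedding_coe_real.isInducing.continuous_iff]
    have : ((fun n : ℤ => (n : ℝ)) ∘ m) = fun t => (θ t - η t) / (2 * Real.pi) := by
      funext t
      have := hm t
      simp only [Function.comp]
      field_simp
      linarith
    rw [this]
    fun_prop
  have hc : m (2 * Real.pi) = m 0 := PreconnectedSpace.constant inferInstance hmc
  have e1 := hm (2 * Real.pi)
  have e2 := hm 0
  rw [hc] at e1
  have : (2 * Real.pi) * (d : ℝ) = (2 * Real.pi) * (e : ℝ) := by linarith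
  exact_mod_cast mul_left_cancel₀ hpi.ne' this

theorem HasVMODegree.unique {f : Circle → Circle} {d e : ℤ}
    (hd : HasVMODegree f d) (he : HasVMODegree f e) : d = e := by
  obtain ⟨ε, ⟨g, hg, hgd⟩, ⟨g', hg', hge⟩⟩ := (hd.and he).exists
  have : g = g' := by
    funext x
    exact Circle.ext ((hg x).2.trans (hg' x).2.symm)
  subst this
  exact hgd.unique hge

open Classical in
/-- The VMO degree of `f`, well defined by `HasVMODegree.unique`; the value `0` is a default for maps
that have no degree. -/
noncomputable def vmoDegree (f : Circle → Circle) : ℤ :=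
  if h : ∃ d, HasVMODegree f d then h.choose else 0

/-! Write `F t = f (exp t)` and sample `F` at `n` equidistant points starting from a base point `x`.
Adding up the signed angles between neighbours gives `discreteTurn F n x`, a discrete substitute for
`2π deg f`. When each step is subdivided into `m` smaller ones, the angle of a step changes by a
multiple of `2π`, and a nonzero change forces the short chain to have length at least `1`. Hölder
then bounds the change by the `p`-variation of the chain times `m ^ (p - 1)`. The constant is
therefore uniform as long as `m ^ (p - 1) ≤ 2`, which permits jumping over `K ≈ 1 / (p - 1)` dyadic
scales at once (`abs_sum_angleStep_sub_le`).

Averaged over `x`, the `p`-variations at all dyadic scales together cost at most a multiple of the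
energy, because each is controlled by the energy density on its own interval of shifts
(`sum_lintegral_discreteVariation_le`). Start from the turning at one sample point, which is `0`,
and move up in jumps of `K` scales. The `K` residue classes modulo `K` use disjoint sets of scales,
so the sum of `K` consecutive mean turnings is still bounded by one copy of the energy
(`sum_lintegral_discreteTurn_le`). At fine scales each of these `K` terms is at least a constant
times `|deg f|`, so `|deg f|` is at most a constant times the energy over `K`, which is the factor
`p - 1`.

The link with the VMO degree is that small energy near `t = 0` makes the arc means close to `f` at
all sample points, for most `x`. The winding number of the normalized means is then the discrete
turning divided by `2π` (`exists_winding_at_scale`), and overlapping ranges of scales show that it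
does not depend on `ε` (`exists_hasVMODegree`). -/

/-! ### Signed angles along chains of points. -/

/-- The signed angle in `(-π, π]` from `z` to `w`. -/
noncomputable def angleStep (z w : Circle) : ℝ := Complex.arg ((w / z : Circle) : ℂ)

theorem exp_angleStep (z w : Circle) : Circle.exp (angleStep z w) = w / z :=
  Circle.exp_arg _

theorem abs_angleStep_le_pi (z w : Circle) : |angleStep z w| ≤ Real.pi :=
  Complex.abs_arg_le_pi _

theorem angleStep_self (z : Circle) : angleStep z z = 0 := by
  simp [angleStep]

theorem Circle.dist_eq_norm_coe_sub (z w : Circle) : dist z w = ‖(z : ℂ) - w‖ :=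
  dist_eq_norm (z : ℂ) w

theorem abs_angleStep_le_dist (z w : Circle) : |angleStep z w| ≤ Real.pi / 2 * dist z w := by
  have h := Complex.angle_le_mul_norm_sub (Circle.norm_coe w) (Circle.norm_coe z)
  rw [Complex.angle_eq_abs_arg (Circle.coe_ne_zero w) (Circle.coe_ne_zero z)] at h
  rw [dist_comm, Circle.dist_eq_norm_coe_sub]
  simpa [angleStep] using h

theorem continuous_circle_coe : Continuous fun z : Circle => (z : ℂ) := by fun_prop

theorem measurable_angleStep_comp {F G : ℝ → Circle} (hF : Measurable F) (hG : Measurable G) :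
    Measurable fun x => angleStep (F x) (G x) := by
  have h1 : Measurable fun x => (F x : ℂ) := continuous_circle_coe.measurable.comp hF
  have h2 : Measurable fun x => (G x : ℂ) := continuous_circle_coe.measurable.comp hG
  have : (fun x => angleStep (F x) (G x)) = fun x => Complex.arg ((G x : ℂ) / (F x : ℂ)) := by
    funext x; simp [angleStep]
  rw [this]
  exact Complex.measurable_arg.comp (h2.div h1)

theorem exp_sum_angleStep (z : ℕ → Circle) (m : ℕ) :
    Circle.exp (∑ i ∈ Finset.range m, angleStep (z i) (z (i + 1))) = z m / z 0 := by
  induction m with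
  | zero => simp
  | succ m ih => rw [Finset.sum_range_succ, Circle.exp_add, ih, exp_angleStep, div_mul_div_cancel']

/-- The defect of additivity of the angle along a chain of `m` points is a multiple of `2π`; when
nonzero it is controlled by the `p`-variation, with a constant independent of `p` as long as
`m ^ (p - 1)` stays bounded. -/
theorem abs_sum_angleStep_sub_le {p : ℝ} (hp : 1 ≤ p) (z : ℕ → Circle) (m : ℕ)
    (hm : (m : ℝ) ^ (p - 1) ≤ 2) :
    |∑ i ∈ Finset.range m, angleStep (z i) (z (i + 1)) - angleStep (z 0) (z m)| ≤
      2 * Real.pi * ∑ i ∈ Finset.range m, dist (z i) (z (i + 1)) ^ p := by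
  set S := ∑ i ∈ Finset.range m, angleStep (z i) (z (i + 1)) with hS
  set V := ∑ i ∈ Finset.range m, dist (z i) (z (i + 1)) ^ p with hV
  set T := ∑ i ∈ Finset.range m, dist (z i) (z (i + 1)) with hT
  have hpi := Real.pi_pos
  have hV0 : 0 ≤ V := Finset.sum_nonneg fun i _ => Real.rpow_nonneg dist_nonneg _
  obtain ⟨n, hn⟩ := Circle.exp_eq_exp.1
    ((exp_sum_angleStep z m).trans (exp_angleStep (z 0) (z m)).symm)
  have hdiff : S - angleStep (z 0) (z m) = n * (2 * Real.pi) := by rw [hS]; linarith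
  rcases eq_or_ne n 0 with h0 | h0
  · rw [hdiff, h0]; simp; positivity
  have hn1 : (1 : ℝ) ≤ |(n : ℝ)| := by exact_mod_cast Int.one_le_abs h0
  have habs : |S - angleStep (z 0) (z m)| = |(n : ℝ)| * (2 * Real.pi) := by
    rw [hdiff, abs_mul, abs_of_pos (by positivity : 0 < 2 * Real.pi)]
  have hST : |S| ≤ Real.pi / 2 * T := by
    refine (Finset.abs_sum_le_sum_abs _ _).trans ?_
    rw [hT, Finset.mul_sum]
    exact Finset.sum_le_sum fun i _ => abs_angleStep_le_dist _ _
  have h1 : |S - angleStep (z 0) (z m)| ≤ |S| + Real.pi :=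
    (abs_sub _ _).trans (by linarith [abs_angleStep_le_pi (z 0) (z m)])
  -- The defect is at least `2π`, so the term `π` in `h1` is at most half of it and can be absorbed.
  have h2 : |S - angleStep (z 0) (z m)| ≤ Real.pi * T := by
    have : 1 * (2 * Real.pi) ≤ |(n : ℝ)| * (2 * Real.pi) := by gcongr
    linarith
  -- This is what allows `T ≤ T ^ p` below.
  have hT1 : 1 ≤ T := by
    have : 1 * (2 * Real.pi) ≤ |(n : ℝ)| * (2 * Real.pi) := by gcongr
    by_contra hlt
    have : Real.pi * T < Real.pi * 1 := by gcongr; linarith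
    linarith
  have hHolder : T ^ p ≤ (m : ℝ) ^ (p - 1) * V := by
    have := Real.rpow_sum_le_const_mul_sum_rpow_of_nonneg (Finset.range m) hp
      (f := fun i => dist (z i) (z (i + 1))) (fun i _ => dist_nonneg)
    simpa using this
  have hTp : T ≤ T ^ p := Real.self_le_rpow_of_one_le hT1 hp
  have : T ≤ 2 * V := hTp.trans (hHolder.trans (by gcongr))
  calc |S - angleStep (z 0) (z m)| ≤ Real.pi * T := h2
    _ ≤ Real.pi * (2 * V) := by gcongr
    _ = 2 * Real.pi * V := by ring

/-- The chain is cut into `n` blocks of `m` steps; the defects of the blocks add, and so do their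
variations. -/
theorem abs_sum_angleStep_refine_le {p : ℝ} (hp : 1 ≤ p) (z : ℕ → Circle) (m n : ℕ)
    (hm : (m : ℝ) ^ (p - 1) ≤ 2) :
    |∑ i ∈ Finset.range (n * m), angleStep (z i) (z (i + 1)) -
        ∑ j ∈ Finset.range n, angleStep (z (j * m)) (z ((j + 1) * m))| ≤
      2 * Real.pi * ∑ i ∈ Finset.range (n * m), dist (z i) (z (i + 1)) ^ p := by
  induction n with
  | zero => simp
  | succ n ih =>
    rw [add_mul, one_mul, Finset.sum_range_add, Finset.sum_range_succ _ n,
      Finset.sum_range_add (fun i => dist (z i) (z (i + 1)) ^ p), mul_add]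
    have h := abs_sum_angleStep_sub_le hp (fun i => z (n * m + i)) m hm
    simp only [add_zero] at h
    have e : (n + 1) * m = n * m + m := by ring
    rw [e]
    have h' := (abs_add_le _ _).trans (add_le_add ih h)
    refine le_trans (le_of_eq ?_) h'
    congr 1
    simp only [add_assoc]
    ring

/-! ### Turning and variation of equidistant samples. -/

/-- The total turning of `F` sampled at `n` equidistant points of one period `[x, x + 2π]`. -/
noncomputable def discreteTurn (F : ℝ → Circle) (n : ℕ) (x : ℝ) : ℝ :=
  ∑ i ∈ Finset.range n, angleStep (F (x + i * (2 * Real.pi / n)))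
    (F (x + (i + 1 : ℕ) * (2 * Real.pi / n)))

/-- The `p`-variation of `F` sampled at `n` equidistant points of one period `[x, x + 2π]`. -/
noncomputable def discreteVariation (p : ℝ) (F : ℝ → Circle) (n : ℕ) (x : ℝ) : ℝ :=
  ∑ i ∈ Finset.range n, dist (F (x + i * (2 * Real.pi / n)))
    (F (x + (i + 1 : ℕ) * (2 * Real.pi / n))) ^ p

theorem abs_discreteTurn_mul_sub_le {p : ℝ} (hp : 1 ≤ p) (F : ℝ → Circle) {m n : ℕ} (hm0 : m ≠ 0)
    (hn0 : n ≠ 0) (hm : (m : ℝ) ^ (p - 1) ≤ 2) (x : ℝ) :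
    |discreteTurn F (n * m) x - discreteTurn F n x| ≤
      2 * Real.pi * discreteVariation p F (n * m) x := by
  have h := abs_sum_angleStep_refine_le hp
    (fun i : ℕ => F (x + i * (2 * Real.pi / (n * m : ℕ)))) m n hm
  have e : ∀ j : ℕ, ((j * m : ℕ) : ℝ) * (2 * Real.pi / (n * m : ℕ)) = j * (2 * Real.pi / n) := by
    intro j
    have : (m : ℝ) ≠ 0 := by exact_mod_cast hm0
    have : (n : ℝ) ≠ 0 := by exact_mod_cast hn0
    push_cast
    field_simp
  simp only [e] at h
  exact h

theorem discreteTurn_one {F : ℝ → Circle} (hF : Function.Periodic F (2 * Real.pi)) (x : ℝ) :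
    discreteTurn F 1 x = 0 := by
  simp [discreteTurn, hF x, angleStep_self]

theorem measurable_discreteTurn {F : ℝ → Circle} (hF : Measurable F) (n : ℕ) :
    Measurable (discreteTurn F n) := by
  unfold discreteTurn
  refine Finset.measurable_sum _ fun i _ => ?_
  exact measurable_angleStep_comp (hF.comp (measurable_id.add_const _))
    (hF.comp (measurable_id.add_const _))

/-! ### Lifts and their increment over a period. -/

/-- Both angles are below `π / 2` in absolute value, so their difference lies in `(-π, π)` and
carries no `2π` ambiguity. -/
theorem angleStep_sub_angleStep {c c' g : Circle} (h : 0 < ((g / c : Circle) : ℂ).re)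
    (h' : 0 < ((g / c' : Circle) : ℂ).re) :
    angleStep c g - angleStep c' g = angleStep c c' := by
  have h1 : |angleStep c g| < Real.pi / 2 := Complex.abs_arg_lt_pi_div_two_iff.2 (Or.inl h)
  have h2 : |angleStep c' g| < Real.pi / 2 := Complex.abs_arg_lt_pi_div_two_iff.2 (Or.inl h')
  rw [abs_lt] at h1 h2
  have e : Circle.exp (angleStep c g - angleStep c' g) = c' / c := by
    rw [Circle.exp_sub, exp_angleStep, exp_angleStep]
    simp
  have := Circle.arg_exp (x := angleStep c g - angleStep c' g) (by linarith) (by linarith)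
  rw [e] at this
  exact this.symm

/-- The angle measured from `c` is continuous on the half-plane around `c`, so up to a constant it
is a second lift; lifts on an interval are unique. -/
theorem lift_sub_lift_eq {g : ℝ → Circle} {θ : ℝ → ℝ} (hθ : Continuous θ)
    (hg : ∀ t, g t = Circle.exp (θ t)) {c : Circle} {a b : ℝ} (hab : a ≤ b)
    (hre : ∀ t ∈ Set.Icc a b, 0 < ((g t / c : Circle) : ℂ).re) :
    θ b - θ a = angleStep c (g b) - angleStep c (g a) := by
  have hgc : Continuous g := by
    rw [show g = fun t => Circle.exp (θ t) from funext hg]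
    exact Circle.exp.continuous.comp hθ
  have hcont : ContinuousOn (fun t => angleStep c (g t)) (Set.Icc a b) := by
    intro t ht
    have h1 : ContinuousAt Complex.arg ((g t / c : Circle) : ℂ) :=
      Complex.continuousAt_arg (Or.inl (hre t ht))
    have h2 : ContinuousAt (fun t => ((g t / c : Circle) : ℂ)) t :=
      (continuous_circle_coe.comp (hgc.div' continuous_const)).continuousAt
    exact (ContinuousAt.comp (f := fun t => ((g t / c : Circle) : ℂ)) h1 h2).continuousWithinAt
  have key := Circle.isCoveringMap_exp.eqOn_of_comp_eqOn (isPreconnected_Icc (a := a) (b := b))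
    (g₁ := θ) (g₂ := fun t => angleStep c (g t) + (θ a - angleStep c (g a)))
    hθ.continuousOn (hcont.add continuousOn_const)
    (by
      intro t _
      simp only [Function.comp, Circle.exp_add, Circle.exp_sub, exp_angleStep, ← hg]
      simp)
    (Set.left_mem_Icc.2 hab) (by simp)
  have := key (Set.right_mem_Icc.2 hab)
  simp only at this
  linarith

/-- The increment of a lift over one period is the discrete turning of any sampled map that stays
close to it. -/
theorem lift_period_eq_discreteTurn {F g : ℝ → Circle} {θ : ℝ → ℝ} (hθ : Continuous θ)
    (hFper : Function.Periodic F (2 * Real.pi)) (hgper : Function.Periodic g (2 * Real.pi))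
    (hg : ∀ t, g t = Circle.exp (θ t)) {n : ℕ} (hn : n ≠ 0) (x : ℝ)
    (hre : ∀ i : ℕ, ∀ t ∈ Set.Icc (x + i * (2 * Real.pi / n)) (x + (i + 1 : ℕ) * (2 * Real.pi / n)),
      0 < ((g t / F (x + i * (2 * Real.pi / n)) : Circle) : ℂ).re) :
    θ (x + 2 * Real.pi) - θ x = discreteTurn F n x := by
  set ρ := 2 * Real.pi / n with hρ
  have hρ0 : 0 ≤ ρ := by positivity
  have hle : ∀ i : ℕ, x + i * ρ ≤ x + (i + 1 : ℕ) * ρ := by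
    intro i; push_cast; linarith
  -- The last bracket is the deviation of `g` from `F` at the two ends; it telescopes and cancels
  -- over a period.
  have step : ∀ i : ℕ, θ (x + (i + 1 : ℕ) * ρ) - θ (x + i * ρ) =
      angleStep (F (x + i * ρ)) (F (x + (i + 1 : ℕ) * ρ)) +
        (angleStep (F (x + (i + 1 : ℕ) * ρ)) (g (x + (i + 1 : ℕ) * ρ)) -
          angleStep (F (x + i * ρ)) (g (x + i * ρ))) := by
    intro i
    rw [lift_sub_lift_eq hθ hg (hle i) (hre i),
      ← angleStep_sub_angleStep (hre i _ (Set.right_mem_Icc.2 (hle i)))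
        (hre (i + 1) _ (Set.left_mem_Icc.2 (hle (i + 1))))]
    ring
  have hnρ : (n : ℝ) * ρ = 2 * Real.pi := by
    have : (n : ℝ) ≠ 0 := by exact_mod_cast hn
    rw [hρ]; field_simp
  have tele := Finset.sum_range_sub (fun i : ℕ => θ (x + i * ρ)) n
  have tele' := Finset.sum_range_sub (fun i : ℕ => angleStep (F (x + i * ρ)) (g (x + i * ρ))) n
  rw [Finset.sum_congr rfl (fun i _ => step i), Finset.sum_add_distrib, tele'] at tele
  simp only [hnρ, Nat.cast_zero, zero_mul, add_zero, hFper x, hgper x, sub_self] at tele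
  exact tele.symm

theorem exists_lift {g : ℝ → Circle} (hg : Continuous g) :
    ∃ θ : ℝ → ℝ, Continuous θ ∧ ∀ t, g t = Circle.exp (θ t) := by
  obtain ⟨θ, ⟨-, h⟩, -⟩ := Circle.isCoveringMap_exp.existsUnique_continuousMap_lifts ⟨g, hg⟩ 0
    (Complex.arg (g 0)) (by simp)
  exact ⟨θ, θ.continuous, fun t => (congrFun h t).symm⟩

theorem lift_period_eq {g : ℝ → Circle} {θ : ℝ → ℝ} (hθ : Continuous θ)
    (hgper : Function.Periodic g (2 * Real.pi)) (hg : ∀ t, g t = Circle.exp (θ t)) (x : ℝ) :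
    θ (x + 2 * Real.pi) - θ x = θ (2 * Real.pi) - θ 0 := by
  have key := Circle.isCoveringMap_exp.eqOn_of_comp_eqOn (isPreconnected_univ (α := ℝ))
    (g₁ := fun t => θ (t + 2 * Real.pi)) (g₂ := fun t => θ t + (θ (2 * Real.pi) - θ 0))
    (hθ.comp (continuous_id.add continuous_const)).continuousOn
    (hθ.add continuous_const).continuousOn
    (by
      intro t _
      have h0 := hgper 0
      rw [zero_add] at h0
      simp only [Function.comp, Circle.exp_add, Circle.exp_sub, ← hg, hgper t, h0]
      simp)
    (Set.mem_univ 0) (by simp)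
  have := key (Set.mem_univ x)
  simp only at this
  linarith

theorem exists_lift_period_eq {g : ℝ → Circle} {θ : ℝ → ℝ}
    (hgper : Function.Periodic g (2 * Real.pi)) (hg : ∀ t, g t = Circle.exp (θ t)) :
    ∃ d : ℤ, θ (2 * Real.pi) - θ 0 = 2 * Real.pi * d := by
  have h0 := hgper 0
  rw [zero_add, hg, hg] at h0
  obtain ⟨m, hm⟩ := Circle.exp_eq_exp.1 h0
  exact ⟨m, by linarith⟩

/-! ### Energy of shifts and summation over dyadic scales. -/

theorem lintegral_period_eq {u : ℝ → ENNReal} (hu : Function.Periodic u (2 * Real.pi)) (a b : ℝ) :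
    ∫⁻ x in Set.Ioc a (a + 2 * Real.pi), u x = ∫⁻ x in Set.Ioc b (b + 2 * Real.pi), u x := by
  refine (isAddFundamentalDomain_Ioc Real.two_pi_pos a).setLIntegral_eq
    (isAddFundamentalDomain_Ioc Real.two_pi_pos b) u ?_
  rintro ⟨g, hg⟩ x
  obtain ⟨n, rfl⟩ := AddSubgroup.mem_zmultiples_iff.1 hg
  change u (n • (2 * Real.pi) + x) = u x
  rw [add_comm]
  exact hu.zsmul n x

theorem setLIntegral_comp_add_right (u : ℝ → ENNReal) (a b c : ℝ) :
    ∫⁻ x in Set.Ioc a b, u (x + c) = ∫⁻ x in Set.Ioc (a + c) (b + c), u x := by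
  have h := (measurePreserving_add_right volume c).setLIntegral_comp_preimage_emb
    (measurableEmbedding_addRight c) u (Set.Ioc (a + c) (b + c))
  simpa using h

theorem lintegral_period_comp_add {u : ℝ → ENNReal} (hu : Function.Periodic u (2 * Real.pi))
    (c : ℝ) :
    ∫⁻ x in Set.Ioc (-Real.pi) Real.pi, u (x + c) =
      ∫⁻ x in Set.Ioc (-Real.pi) Real.pi, u x := by
  rw [setLIntegral_comp_add_right]
  have h := lintegral_period_eq hu (-Real.pi + c) (-Real.pi)
  rwa [show -Real.pi + c + 2 * Real.pi = Real.pi + c by ring,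
    show -Real.pi + 2 * Real.pi = Real.pi by ring] at h

/-- The integral over a period of `|F (x + t) - F x| ^ p`. -/
noncomputable def shiftEnergy (p : ℝ) (F : ℝ → Circle) (t : ℝ) : ENNReal :=
  ∫⁻ x in Set.Ioc (-Real.pi) Real.pi, ENNReal.ofReal (dist (F (x + t)) (F x) ^ p)

/-- The integral over a period of `|F (x + t) - F x| ^ p / t ^ 2`. -/
noncomputable def energyDensity (p : ℝ) (F : ℝ → Circle) (t : ℝ) : ENNReal :=
  ∫⁻ x in Set.Ioc (-Real.pi) Real.pi, ENNReal.ofReal (dist (F (x + t)) (F x) ^ p / t ^ 2)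

section
variable {p : ℝ} {F : ℝ → Circle}

theorem measurable_dist_shift (p : ℝ) (hF : Measurable F) :
    Measurable fun q : ℝ × ℝ => dist (F (q.1 + q.2)) (F q.1) ^ p :=
  ((hF.comp (measurable_fst.add measurable_snd)).dist (hF.comp measurable_fst)).pow_const p

theorem measurable_ofReal_dist_shift (p : ℝ) (hF : Measurable F) (t : ℝ) :
    Measurable fun x => ENNReal.ofReal (dist (F (x + t)) (F x) ^ p) :=
  (((hF.comp (measurable_id.add_const t)).dist hF).pow_const p).ennreal_ofReal

theorem measurable_shiftEnergy (hF : Measurable F) : Measurable (shiftEnergy p F) :=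
  Measurable.lintegral_prod_left' (f := fun q : ℝ × ℝ =>
    ENNReal.ofReal (dist (F (q.1 + q.2)) (F q.1) ^ p)) (measurable_dist_shift p hF).ennreal_ofReal

theorem shiftEnergy_le_energyDensity (hp : 1 ≤ p) {t r : ℝ} (ht : |t| ≤ r) :
    shiftEnergy p F t ≤ ENNReal.ofReal (r ^ 2) * energyDensity p F t := by
  rw [shiftEnergy, energyDensity, ← lintegral_const_mul' _ _ ENNReal.ofReal_ne_top]
  refine lintegral_mono fun x => ?_
  rw [← ENNReal.ofReal_mul (sq_nonneg r)]
  refine ENNReal.ofReal_le_ofReal ?_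
  rcases eq_or_ne t 0 with rfl | h0
  · simp [Real.zero_rpow (by linarith : p ≠ 0)]
  · have h1 : t ^ 2 ≤ r ^ 2 := sq_le_sq.2 (ht.trans (le_abs_self r))
    have h2 : 0 < t ^ 2 := by positivity
    have h3 : 0 ≤ dist (F (x + t)) (F x) ^ p := by positivity
    rw [mul_div_assoc', le_div_iff₀ h2, mul_comm]
    gcongr

theorem periodic_dist_shift (hF : Function.Periodic F (2 * Real.pi)) (a b : ℝ) :
    Function.Periodic (fun x => ENNReal.ofReal (dist (F (x + a)) (F (x + b)) ^ p))
      (2 * Real.pi) := by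
  intro x
  simp only
  rw [show x + 2 * Real.pi + a = x + a + 2 * Real.pi by ring,
    show x + 2 * Real.pi + b = x + b + 2 * Real.pi by ring, hF, hF]

theorem rpow_add_le_two_mul (hp : 1 ≤ p) (hp2 : p ≤ 2) {a b : ℝ} (ha : 0 ≤ a) (hb : 0 ≤ b) :
    (a + b) ^ p ≤ 2 * (a ^ p + b ^ p) := by
  have h := NNReal.rpow_add_le_mul_rpow_add_rpow ⟨a, ha⟩ ⟨b, hb⟩ hp
  have h' : (a + b) ^ p ≤ 2 ^ (p - 1) * (a ^ p + b ^ p) := by exact_mod_cast h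
  have h2 : (2 : ℝ) ^ (p - 1) ≤ 2 := by
    calc (2 : ℝ) ^ (p - 1) ≤ 2 ^ (1 : ℝ) := by
          apply Real.rpow_le_rpow_of_exponent_le <;> linarith
      _ = 2 := by simp
  refine h'.trans ?_
  gcongr

theorem shiftEnergy_add_le (hp : 1 ≤ p) (hp2 : p ≤ 2) (hFm : Measurable F)
    (hF : Function.Periodic F (2 * Real.pi)) (s t : ℝ) :
    shiftEnergy p F (s + t) ≤ 2 * (shiftEnergy p F s + shiftEnergy p F t) := by
  have e : shiftEnergy p F s = ∫⁻ x in Set.Ioc (-Real.pi) Real.pi,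
      ENNReal.ofReal (dist (F (x + t + s)) (F (x + t)) ^ p) := by
    have := periodic_dist_shift (p := p) hF s 0
    simp only [add_zero] at this
    exact (lintegral_period_comp_add this t).symm
  have m1 := measurable_ofReal_dist_shift p hFm t
  rw [e, shiftEnergy, shiftEnergy, ← lintegral_add_right _ m1,
    ← lintegral_const_mul' _ _ ENNReal.ofNat_ne_top]
  refine lintegral_mono fun x => ?_
  rw [← ENNReal.ofReal_add (by positivity) (by positivity), ← ENNReal.ofReal_ofNat 2,
    ← ENNReal.ofReal_mul (by norm_num)]
  refine ENNReal.ofReal_le_ofReal ?_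
  refine le_trans ?_ (rpow_add_le_two_mul hp hp2 dist_nonneg dist_nonneg)
  rw [show x + (s + t) = x + t + s by ring]
  gcongr
  exact dist_triangle _ _ _

/-- Split the shift `r` as `(r - t) + t` and average over the middle third of `[0, r]`, which `t ↦ r
- t` preserves. -/
theorem shiftEnergy_le_lintegral (hp : 1 ≤ p) (hp2 : p ≤ 2) (hFm : Measurable F)
    (hF : Function.Periodic F (2 * Real.pi)) (r : ℝ) :
    ENNReal.ofReal (r / 3) * shiftEnergy p F r ≤
      4 * ∫⁻ t in Set.Ioo (r / 3) (2 * r / 3), shiftEnergy p F t := by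
  have hm := measurable_shiftEnergy (p := p) hFm
  have hvol : volume (Set.Ioo (r / 3) (2 * r / 3)) = ENNReal.ofReal (r / 3) := by
    rw [Real.volume_Ioo]; congr 1; ring
  have hrefl : ∫⁻ t in Set.Ioo (r / 3) (2 * r / 3), shiftEnergy p F (r - t) =
      ∫⁻ t in Set.Ioo (r / 3) (2 * r / 3), shiftEnergy p F t := by
    rw [← lintegral_indicator measurableSet_Ioo, ← lintegral_indicator measurableSet_Ioo,
      ← lintegral_sub_left_eq_self _ r]
    refine lintegral_congr fun t => ?_
    simp only [Set.indicator, Set.mem_Ioo, sub_sub_cancel]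
    congr 1
    refine propext ⟨fun h => ⟨?_, ?_⟩, fun h => ⟨?_, ?_⟩⟩ <;> linarith [h.1, h.2]
  calc ENNReal.ofReal (r / 3) * shiftEnergy p F r
      = ∫⁻ t in Set.Ioo (r / 3) (2 * r / 3), shiftEnergy p F r := by
        rw [setLIntegral_const, hvol, mul_comm]
    _ ≤ ∫⁻ t in Set.Ioo (r / 3) (2 * r / 3),
          2 * (shiftEnergy p F (r - t) + shiftEnergy p F t) := by
        refine lintegral_mono fun t => ?_
        simpa using shiftEnergy_add_le hp hp2 hFm hF (r - t) t
    _ = 4 * ∫⁻ t in Set.Ioo (r / 3) (2 * r / 3), shiftEnergy p F t := by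
        rw [lintegral_const_mul' _ _ ENNReal.ofNat_ne_top, lintegral_add_right _ hm, hrefl,
          ← two_mul, ← mul_assoc]
        norm_num

theorem natCast_mul_shiftEnergy_le (hp : 1 ≤ p) (hp2 : p ≤ 2) (hFm : Measurable F)
    (hF : Function.Periodic F (2 * Real.pi)) {n : ℕ} (hn : n ≠ 0) :
    n * shiftEnergy p F (2 * Real.pi / n) ≤ ENNReal.ofReal (24 * Real.pi) *
      ∫⁻ t in Set.Ioo (2 * Real.pi / n / 3) (2 * (2 * Real.pi / n) / 3), energyDensity p F t := by
  have hn' : (0 : ℝ) < n := by exact_mod_cast Nat.pos_of_ne_zero hn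
  have hpi := Real.pi_pos
  set r := 2 * Real.pi / n with hr
  have hr0 : 0 < r := by positivity
  have h1 := shiftEnergy_le_lintegral hp hp2 hFm hF r
  have h2 : ∫⁻ t in Set.Ioo (r / 3) (2 * r / 3), shiftEnergy p F t ≤
      ENNReal.ofReal (r ^ 2) * ∫⁻ t in Set.Ioo (r / 3) (2 * r / 3), energyDensity p F t := by
    rw [← lintegral_const_mul' _ _ ENNReal.ofReal_ne_top]
    refine setLIntegral_mono' measurableSet_Ioo fun t ht => ?_
    refine shiftEnergy_le_energyDensity hp ?_
    rw [abs_le]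
    constructor <;> linarith [ht.1, ht.2]
  have e1 : (n : ENNReal) = ENNReal.ofReal (6 * Real.pi / r ^ 2) * ENNReal.ofReal (r / 3) := by
    rw [← ENNReal.ofReal_mul (by positivity), ← ENNReal.ofReal_natCast]
    congr 1
    rw [hr]; field_simp; norm_num
  have e2 : ENNReal.ofReal (24 * Real.pi) =
      ENNReal.ofReal (6 * Real.pi / r ^ 2) * (4 * ENNReal.ofReal (r ^ 2)) := by
    rw [← ENNReal.ofReal_ofNat 4, ← ENNReal.ofReal_mul (by norm_num),
      ← ENNReal.ofReal_mul (by positivity)]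
    congr 1
    field_simp; norm_num
  rw [e1, e2, mul_assoc, mul_assoc, mul_assoc]
  exact mul_le_mul_right (h1.trans (mul_le_mul_right h2 4)) _

theorem lintegral_sum_comp_add {u : ℝ → ENNReal} (hu : Function.Periodic u (2 * Real.pi))
    (hum : Measurable u) (n : ℕ) (a : ℕ → ℝ) :
    ∫⁻ x in Set.Ioc (-Real.pi) Real.pi, ∑ i ∈ Finset.range n, u (x + a i) =
      n * ∫⁻ x in Set.Ioc (-Real.pi) Real.pi, u x := by
  rw [lintegral_finsetSum (f := fun i x => u (x + a i)) _
    fun i _ => hum.comp (measurable_id.add_const _)]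
  simp [lintegral_period_comp_add hu]

theorem discreteVariation_nonneg (p : ℝ) (F : ℝ → Circle) (n : ℕ) (x : ℝ) :
    0 ≤ discreteVariation p F n x :=
  Finset.sum_nonneg fun _ _ => Real.rpow_nonneg dist_nonneg _

theorem lintegral_discreteVariation (hFm : Measurable F)
    (hF : Function.Periodic F (2 * Real.pi)) (n : ℕ) :
    ∫⁻ x in Set.Ioc (-Real.pi) Real.pi, ENNReal.ofReal (discreteVariation p F n x) =
      n * shiftEnergy p F (2 * Real.pi / n) := by
  set r := 2 * Real.pi / n with hr
  have hper := periodic_dist_shift (p := p) hF r 0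
  simp only [add_zero] at hper
  have m1 := measurable_ofReal_dist_shift p hFm r
  rw [shiftEnergy, ← lintegral_sum_comp_add hper m1 n (fun i => i * r)]
  refine lintegral_congr fun x => ?_
  rw [discreteVariation, ENNReal.ofReal_sum_of_nonneg fun i _ => by positivity]
  refine Finset.sum_congr rfl fun i _ => ?_
  rw [dist_comm, ← hr]
  congr 4
  push_cast
  ring

/-- For `r = 2π / 2 ^ k` the intervals `(r / 3, 2r / 3)` are disjoint, so the energy density is
integrated at most once. The scale `k = 0` contributes nothing by periodicity. -/
theorem sum_lintegral_discreteVariation_le (hp : 1 ≤ p) (hp2 : p ≤ 2) (hFm : Measurable F)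
    (hF : Function.Periodic F (2 * Real.pi)) (N : ℕ) :
    ∑ k ∈ Finset.range N, ∫⁻ x in Set.Ioc (-Real.pi) Real.pi,
        ENNReal.ofReal (discreteVariation p F (2 ^ k) x) ≤
      ENNReal.ofReal (24 * Real.pi) *
        ∫⁻ t in Set.Ioc (-Real.pi) Real.pi, energyDensity p F t := by
  have hpi := Real.pi_pos
  have hzero : ∫⁻ x in Set.Ioc (-Real.pi) Real.pi,
      ENNReal.ofReal (discreteVariation p F (2 ^ 0) x) = 0 := by
    have : ∀ x, discreteVariation p F (2 ^ 0) x = 0 := fun x => by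
      simp [discreteVariation, hF x, Real.zero_rpow (by linarith : p ≠ 0)]
    simp only [this, ENNReal.ofReal_zero, lintegral_zero]
  let S : ℕ → Set ℝ := fun k =>
    Set.Ioo (2 * Real.pi / (2 ^ (k + 1) : ℕ) / 3) (2 * (2 * Real.pi / (2 ^ (k + 1) : ℕ)) / 3)
  have hsub : ∀ k, S k ⊆ Set.Ioc (-Real.pi) Real.pi := by
    intro k t ht
    have h1 : (1 : ℝ) ≤ 2 ^ k := one_le_pow₀ (by norm_num)
    have h2 : 2 * Real.pi / (2 ^ (k + 1) : ℕ) ≤ Real.pi := by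
      push_cast
      rw [div_le_iff₀ (by positivity), pow_succ]
      nlinarith
    have h3 : 0 < 2 * Real.pi / (2 ^ (k + 1) : ℕ) := by positivity
    constructor <;> linarith [ht.1, ht.2]
  have hdisj : Pairwise (Function.onFun Disjoint S) := by
    refine (pairwise_disjoint_on S).2 fun j k hjk => ?_
    rw [Set.disjoint_left]
    intro t ht ht'
    have h1 : (2 : ℝ) * 2 ^ (j + 1) ≤ 2 ^ (k + 1) := by
      rw [← pow_succ']
      exact pow_le_pow_right₀ (by norm_num) (by omega)
    have h2 : 2 * (2 * Real.pi / (2 ^ (k + 1) : ℕ)) ≤ 2 * Real.pi / (2 ^ (j + 1) : ℕ) := by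
      push_cast
      rw [mul_div_assoc', div_le_div_iff₀ (by positivity) (by positivity)]
      nlinarith
    linarith [ht.1, ht'.2]
  rcases N with _ | N
  · simp
  rw [Finset.sum_range_succ', hzero, add_zero]
  calc ∑ k ∈ Finset.range N, ∫⁻ x in Set.Ioc (-Real.pi) Real.pi,
        ENNReal.ofReal (discreteVariation p F (2 ^ (k + 1)) x)
      ≤ ∑ k ∈ Finset.range N, ENNReal.ofReal (24 * Real.pi) * ∫⁻ t in S k, energyDensity p F t := by
        refine Finset.sum_le_sum fun k _ => ?_
        rw [lintegral_discreteVariation hFm hF]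
        exact natCast_mul_shiftEnergy_le hp hp2 hFm hF (by positivity)
    _ = ENNReal.ofReal (24 * Real.pi) *
          ∫⁻ t in ⋃ k ∈ Finset.range N, S k, energyDensity p F t := by
        rw [← Finset.mul_sum, lintegral_biUnion_finset (fun j _ k _ h => hdisj h)
          (fun k _ => measurableSet_Ioo)]
    _ ≤ _ := by
        gcongr
        exact Set.iUnion₂_subset fun k _ => hsub k

/-! ### Mean turning over consecutive dyadic scales. -/

theorem lintegral_discreteTurn_mul_le (hp : 1 ≤ p) {m n : ℕ} (hm0 : m ≠ 0) (hn0 : n ≠ 0)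
    (hm : (m : ℝ) ^ (p - 1) ≤ 2) (hFm : Measurable F) :
    ∫⁻ x in Set.Ioc (-Real.pi) Real.pi, ENNReal.ofReal |discreteTurn F (n * m) x| ≤
      (∫⁻ x in Set.Ioc (-Real.pi) Real.pi, ENNReal.ofReal |discreteTurn F n x|) +
        ENNReal.ofReal (2 * Real.pi) * ∫⁻ x in Set.Ioc (-Real.pi) Real.pi,
          ENNReal.ofReal (discreteVariation p F (n * m) x) := by
  have hmeas : Measurable fun x => ENNReal.ofReal |discreteTurn F n x| :=
    (measurable_discreteTurn hFm n).abs.ennreal_ofReal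
  rw [← lintegral_const_mul' _ _ ENNReal.ofReal_ne_top, ← lintegral_add_left hmeas]
  refine lintegral_mono fun x => ?_
  rw [← ENNReal.ofReal_mul (by positivity), ← ENNReal.ofReal_add (abs_nonneg _)
    (mul_nonneg (by positivity) (discreteVariation_nonneg p F _ x))]
  refine ENNReal.ofReal_le_ofReal ?_
  have h := abs_discreteTurn_mul_sub_le hp F hm0 hn0 hm x
  have := abs_sub_abs_le_abs_sub (discreteTurn F (n * m) x) (discreteTurn F n x)
  linarith

/-- The sum of the mean turnings over `K` consecutive dyadic scales is bounded by the energy,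
uniformly in `K ≤ 1 / (p - 1)`. -/
theorem sum_lintegral_discreteTurn_le (hp : 1 ≤ p) (hp2 : p ≤ 2) (hFm : Measurable F)
    (hF : Function.Periodic F (2 * Real.pi)) {K : ℕ} (hK : K * (p - 1) ≤ 1) (N : ℕ) :
    ∑ k ∈ Finset.range K, ∫⁻ x in Set.Ioc (-Real.pi) Real.pi,
        ENNReal.ofReal |discreteTurn F (2 ^ (N + k)) x| ≤
      ENNReal.ofReal (48 * Real.pi ^ 2) *
        ∫⁻ t in Set.Ioc (-Real.pi) Real.pi, energyDensity p F t := by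
  have hpi := Real.pi_pos
  have hpow : ∀ k ≤ K, ((2 ^ k : ℕ) : ℝ) ^ (p - 1) ≤ 2 := by
    intro k hk
    have hk' : (k : ℝ) ≤ K := by exact_mod_cast hk
    push_cast
    rw [← Real.rpow_natCast, ← Real.rpow_mul (by norm_num)]
    calc (2 : ℝ) ^ ((k : ℝ) * (p - 1)) ≤ 2 ^ (1 : ℝ) := by
          apply Real.rpow_le_rpow_of_exponent_le (by norm_num)
          nlinarith
      _ = 2 := by simp
  set w : ℕ → ENNReal := fun k => ∫⁻ x in Set.Ioc (-Real.pi) Real.pi,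
    ENNReal.ofReal |discreteTurn F (2 ^ k) x| with hw
  set e : ℕ → ENNReal := fun k => ∫⁻ x in Set.Ioc (-Real.pi) Real.pi,
    ENNReal.ofReal (discreteVariation p F (2 ^ k) x) with he
  have hstart : ∀ k ≤ K, w k ≤ ENNReal.ofReal (2 * Real.pi) * e k := by
    intro k hk
    have h := lintegral_discreteTurn_mul_le hp (m := 2 ^ k) (n := 1) (by positivity) one_ne_zero
      (hpow k hk) hFm
    simpa [discreteTurn_one hF, hw, he] using h
  have hstep : ∀ k, w (k + K) ≤ w k + ENNReal.ofReal (2 * Real.pi) * e (k + K) := by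
    intro k
    have h := lintegral_discreteTurn_mul_le hp (m := 2 ^ K) (n := 2 ^ k) (by positivity)
      (by positivity) (hpow K le_rfl) hFm
    rw [← pow_add] at h
    exact h
  -- Passing from `N` to `N + 1` trades `w N` for `w (N + K)` at the price of `e (N + K)`, so each
  -- scale is paid for only once.
  have main : ∀ N, ∑ k ∈ Finset.range K, w (N + k) ≤
      ENNReal.ofReal (2 * Real.pi) * ∑ k ∈ Finset.range (N + K), e k := by
    intro N
    induction N with
    | zero =>
      rw [Finset.mul_sum]
      simp only [zero_add]
      exact Finset.sum_le_sum fun k hk => hstart k (Finset.mem_range.1 hk).le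
    | succ N ih =>
      rcases K with _ | K
      · simp
      rw [Finset.sum_range_succ' _ K] at ih
      rw [Finset.sum_range_succ, show N + 1 + (K + 1) = N + (K + 1) + 1 by ring,
        Finset.sum_range_succ _ (N + (K + 1)), mul_add]
      have h1 := hstep N
      have h2 : ∀ k, N + 1 + k = N + (k + 1) := fun k => by ring
      simp only [h2]
      calc _ ≤ ∑ k ∈ Finset.range K, w (N + (k + 1)) +
            (w N + ENNReal.ofReal (2 * Real.pi) * e (N + (K + 1))) := by gcongr
        _ ≤ _ := by
          rw [← add_assoc]
          gcongr
          exact ih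
  refine (main N).trans ?_
  have := sum_lintegral_discreteVariation_le hp hp2 hFm hF (N + K)
  calc _ ≤ ENNReal.ofReal (2 * Real.pi) * (ENNReal.ofReal (24 * Real.pi) *
        ∫⁻ t in Set.Ioc (-Real.pi) Real.pi, energyDensity p F t) := by gcongr
    _ = _ := by
      rw [← mul_assoc, ← ENNReal.ofReal_mul (by positivity)]
      congr 2
      ring

end

/-! ### Comparison with the energy on the circle. -/

theorem Circle.dist_exp_le (x t : ℝ) : dist (Circle.exp x) (Circle.exp (x + t)) ≤ |t| := by
  rw [Circle.exp_add, Circle.dist_eq_norm_coe_sub, norm_sub_rev]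
  have e : ((Circle.exp x * Circle.exp t : Circle) : ℂ) - (Circle.exp x : ℂ) =
      (Circle.exp x : ℂ) * (Complex.exp (Complex.I * t) - 1) := by
    rw [Circle.coe_mul, Circle.coe_exp t, mul_comm Complex.I]
    ring
  rw [e, norm_mul, Circle.norm_coe, one_mul]
  simpa using Real.norm_exp_I_mul_ofReal_sub_one_le (x := t)

instance : IsFiniteMeasure arclength := by
  unfold arclength; infer_instance

theorem lintegral_arclength {u : Circle → ENNReal} (hu : Measurable u) :
    ∫⁻ x, u x ∂arclength = ∫⁻ t in Set.Ioc (-Real.pi) Real.pi, u (Circle.exp t) :=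
  lintegral_map hu Circle.exp.continuous.measurable

theorem lintegral_shiftEnergy_eq {p : ℝ} {F : ℝ → Circle} (hF : Measurable F) (A : Set ℝ) :
    ∫⁻ t in A, shiftEnergy p F t = ∫⁻ x in Set.Ioc (-Real.pi) Real.pi, ∫⁻ t in A,
      ENNReal.ofReal (dist (F (x + t)) (F x) ^ p) := by
  have hm : Measurable (Function.uncurry fun t x : ℝ =>
      ENNReal.ofReal (dist (F (x + t)) (F x) ^ p)) :=
    (((hF.comp (measurable_snd.add measurable_fst)).dist
      (hF.comp measurable_snd)).pow_const p).ennreal_ofReal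
  exact lintegral_lintegral_swap hm.aemeasurable

theorem lintegral_energyDensity_eq {p : ℝ} {F : ℝ → Circle} (hF : Measurable F) (A : Set ℝ) :
    ∫⁻ t in A, energyDensity p F t = ∫⁻ x in Set.Ioc (-Real.pi) Real.pi, ∫⁻ t in A,
      ENNReal.ofReal (dist (F (x + t)) (F x) ^ p / t ^ 2) := by
  have hm : Measurable (Function.uncurry fun t x : ℝ =>
      ENNReal.ofReal (dist (F (x + t)) (F x) ^ p / t ^ 2)) :=
    ((((hF.comp (measurable_snd.add measurable_fst)).dist
      (hF.comp measurable_snd)).pow_const p).div (measurable_fst.pow_const 2)).ennreal_ofReal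
  exact lintegral_lintegral_swap hm.aemeasurable

section
variable {p : ℝ} {f : Circle → Circle}

/-- The chord is at most the arc `|t|`, so replacing it by `|t|` in the denominator lowers the
integrand. Where the two points coincide, the numerator is `0`. -/
theorem lintegral_energyDensity_le (hp : 1 ≤ p) (hf : Measurable f) :
    ∫⁻ t in Set.Ioc (-Real.pi) Real.pi, energyDensity p (fun t => f (Circle.exp t)) t ≤
      ∫⁻ x, ∫⁻ y, ENNReal.ofReal (dist (f x) (f y) ^ p / dist x y ^ 2)
        ∂arclength ∂arclength := by
  have hFm : Measurable fun t => f (Circle.exp t) := hf.comp Circle.exp.continuous.measurable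
  have hm : Measurable fun q : Circle × Circle =>
      ENNReal.ofReal (dist (f q.1) (f q.2) ^ p / dist q.1 q.2 ^ 2) :=
    ((((hf.comp measurable_fst).dist (hf.comp measurable_snd)).pow_const p).div
      ((measurable_fst.dist measurable_snd).pow_const 2)).ennreal_ofReal
  rw [lintegral_arclength hm.lintegral_prod_right']
  rw [lintegral_energyDensity_eq hFm]
  refine lintegral_mono fun x => ?_
  simp only
  rw [lintegral_arclength (u := fun y => ENNReal.ofReal
    (dist (f (Circle.exp x)) (f y) ^ p / dist (Circle.exp x) y ^ 2))
    (((measurable_const.dist hf).pow_const p).div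
      ((measurable_const.dist measurable_id).pow_const 2)).ennreal_ofReal]
  have hper : Function.Periodic (fun y => ENNReal.ofReal
      (dist (f (Circle.exp x)) (f (Circle.exp y)) ^ p /
        dist (Circle.exp x) (Circle.exp y) ^ 2)) (2 * Real.pi) := by
    intro y
    simp only [Circle.exp_add_two_pi]
  rw [← lintegral_period_comp_add hper x]
  refine lintegral_mono fun t => ENNReal.ofReal_le_ofReal ?_
  rw [add_comm t x, dist_comm (f (Circle.exp (x + t)))]
  rcases eq_or_ne (Circle.exp x) (Circle.exp (x + t)) with h | h
  · rw [← h]; simp [Real.zero_rpow (by linarith : p ≠ 0)]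
  · have h0 : 0 < dist (Circle.exp x) (Circle.exp (x + t)) := dist_pos.2 h
    rw [← sq_abs t]
    gcongr
    exact Circle.dist_exp_le x t

/-! ### Arc means, good samples and winding numbers. -/

theorem intervalIntegrable_coe_circle {F : ℝ → Circle} (hF : Measurable F) (a b : ℝ) :
    IntervalIntegrable (fun t => (F t : ℂ)) volume a b := by
  refine (intervalIntegrable_const (c := (1 : ℝ))).mono_fun
    (continuous_circle_coe.measurable.comp hF).aestronglyMeasurable ?_
  exact Eventually.of_forall fun t => by simp [Circle.norm_coe]

theorem arcMean_exp (f : Circle → Circle) (ε t : ℝ) :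
    arcMean f ε (Circle.exp t) =
      ((2 * ε)⁻¹ : ℝ) • ∫ s in (t - ε)..(t + ε), (f (Circle.exp s) : ℂ) := by
  have h := intervalIntegral.integral_comp_add_left (a := -ε) (b := ε)
    (fun s => (f (Circle.exp s) : ℂ)) t
  rw [← sub_eq_add_neg] at h
  rw [arcMean, ← h]
  simp only [Circle.exp_add]

theorem norm_arcMean_sub_le (hf : Measurable f) {ε : ℝ} (hε : 0 < ε) (t t' : ℝ) :
    ‖arcMean f ε (Circle.exp t) - arcMean f ε (Circle.exp t')‖ ≤ |t - t'| / ε := by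
  have hFm : Measurable fun t => f (Circle.exp t) := hf.comp Circle.exp.continuous.measurable
  have hi := intervalIntegrable_coe_circle hFm
  have hb : ∀ a b : ℝ, ‖∫ s in a..b, (f (Circle.exp s) : ℂ)‖ ≤ |b - a| := by
    intro a b
    simpa using intervalIntegral.norm_integral_le_of_norm_le_const (a := a) (b := b) (C := 1)
      (f := fun s => (f (Circle.exp s) : ℂ)) (fun s _ => (Circle.norm_coe _).le)
  rw [arcMean_exp, arcMean_exp, ← smul_sub,
    intervalIntegral.integral_interval_sub_interval_comm (hi _ _) (hi _ _) (hi _ _), norm_smul,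
    Real.norm_of_nonneg (by positivity)]
  have h1 := hb (t - ε) (t' - ε)
  have h2 := hb (t + ε) (t' + ε)
  rw [show t' - ε - (t - ε) = -(t - t') by ring, abs_neg] at h1
  rw [show t' + ε - (t + ε) = -(t - t') by ring, abs_neg] at h2
  calc _ ≤ (2 * ε)⁻¹ * (|t - t'| + |t - t'|) := by
        gcongr
        exact (norm_sub_le _ _).trans (add_le_add h1 h2)
    _ = |t - t'| / ε := by field_simp; ring

theorem continuous_arcMean_exp (hf : Measurable f) {ε : ℝ} (hε : 0 < ε) :
    Continuous fun t => arcMean f ε (Circle.exp t) := by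
  refine (LipschitzWith.of_dist_le_mul (K := ⟨ε⁻¹, by positivity⟩) fun t t' => ?_).continuous
  rw [dist_eq_norm, Real.dist_eq]
  refine (norm_arcMean_sub_le hf hε t t').trans (le_of_eq ?_)
  rw [div_eq_inv_mul]
  rfl

theorem norm_arcMean_sub_self_le (hp : 1 ≤ p) (hp2 : p ≤ 2) (hf : Measurable f) {ε : ℝ}
    (hε : 0 < ε) (x : ℝ) :
    ‖arcMean f ε (Circle.exp x) - f (Circle.exp x)‖ ≤
      1 / 4 + 16 / ε * ∫ s in (-ε)..ε, dist (f (Circle.exp (x + s))) (f (Circle.exp x)) ^ p := by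
  have hFm : Measurable fun s => f (Circle.exp (x + s)) :=
    hf.comp (Circle.exp.continuous.measurable.comp (measurable_const_add x))
  have hi := intervalIntegrable_coe_circle hFm (-ε) ε
  have hd : Measurable fun s => dist (f (Circle.exp (x + s))) (f (Circle.exp x)) :=
    hFm.dist measurable_const
  have hd2 : ∀ z w : Circle, dist z w ≤ 2 := by
    intro z w
    rw [Circle.dist_eq_norm_coe_sub]
    refine (norm_sub_le _ _).trans ?_
    rw [Circle.norm_coe, Circle.norm_coe]; norm_num
  have hpi : IntervalIntegrable
      (fun s => dist (f (Circle.exp (x + s))) (f (Circle.exp x)) ^ p) volume (-ε) ε := by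
    refine (intervalIntegrable_const (c := (2 : ℝ) ^ p)).mono_fun
      (hd.pow_const p).aestronglyMeasurable ?_
    refine Eventually.of_forall fun s => ?_
    simp only
    rw [Real.norm_of_nonneg (by positivity), Real.norm_of_nonneg (by positivity)]
    gcongr
    exact hd2 _ _
  -- If `d > 1 / 4` then `1 ≤ (4d) ^ p ≤ 16 d ^ p`, and `d ≤ 2`. Linear oscillation is thus traded
  -- for `p`-oscillation with a constant free of `p`.
  have hpt : ∀ d : ℝ, 0 ≤ d → d ≤ 2 → d ≤ 1 / 4 + 32 * d ^ p := by
    intro d h0 h2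
    rcases le_or_gt d (1 / 4) with h | h
    · have : 0 ≤ d ^ p := by positivity
      linarith
    · have h1 : 1 ≤ (4 * d) ^ p := Real.one_le_rpow (by linarith) (by linarith)
      rw [Real.mul_rpow (by norm_num) h0] at h1
      have h3 : (4 : ℝ) ^ p ≤ 4 ^ (2 : ℝ) := Real.rpow_le_rpow_of_exponent_le (by norm_num) hp2
      have h4 : (4 : ℝ) ^ (2 : ℝ) = 16 := by norm_num
      have : 0 ≤ d ^ p := by positivity
      nlinarith
  have e : arcMean f ε (Circle.exp x) - f (Circle.exp x) =
      ((2 * ε)⁻¹ : ℝ) • ∫ s in (-ε)..ε, ((f (Circle.exp (x + s)) : ℂ) - f (Circle.exp x)) := by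
    rw [intervalIntegral.integral_sub hi intervalIntegrable_const, arcMean,
      intervalIntegral.integral_const, smul_sub, smul_smul]
    have : (2 * ε)⁻¹ * (ε - -ε) = 1 := by field_simp; norm_num
    rw [this, one_smul]
    simp only [Circle.exp_add]
  rw [e, norm_smul, Real.norm_of_nonneg (by positivity)]
  have hnorm : ‖∫ s in (-ε)..ε, ((f (Circle.exp (x + s)) : ℂ) - f (Circle.exp x))‖ ≤
      ∫ s in (-ε)..ε, (1 / 4 + 32 * dist (f (Circle.exp (x + s))) (f (Circle.exp x)) ^ p) := by
    refine intervalIntegral.norm_integral_le_of_norm_le (by linarith) ?_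
      (intervalIntegrable_const.add (hpi.const_mul 32))
    refine Eventually.of_forall fun s _ => ?_
    rw [← Circle.dist_eq_norm_coe_sub]
    exact hpt _ dist_nonneg (hd2 _ _)
  rw [intervalIntegral.integral_add intervalIntegrable_const (hpi.const_mul 32),
    intervalIntegral.integral_const_mul, intervalIntegral.integral_const] at hnorm
  calc _ ≤ (2 * ε)⁻¹ * _ := mul_le_mul_of_nonneg_left hnorm (by positivity)
    _ = _ := by simp only [smul_eq_mul]; field_simp; ring

/-- The average `p`-oscillation of `f` at scale `ε` around `exp x`. -/
noncomputable def localOscillation (p : ℝ) (f : Circle → Circle) (ε x : ℝ) : ENNReal :=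
  ENNReal.ofReal (64 / ε) * ∫⁻ s in Set.Ioc (-ε) ε,
    ENNReal.ofReal (dist (f (Circle.exp (x + s))) (f (Circle.exp x)) ^ p)

theorem one_le_localOscillation (hp : 1 ≤ p) (hp2 : p ≤ 2) (hf : Measurable f) {ε : ℝ}
    (hε : 0 < ε) {x : ℝ} (hx : 1 / 2 < ‖arcMean f ε (Circle.exp x) - f (Circle.exp x)‖) :
    1 ≤ localOscillation p f ε x := by
  have h := norm_arcMean_sub_self_le hp hp2 hf hε x
  have hI : 1 ≤ 64 / ε * ∫ s in (-ε)..ε,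
      dist (f (Circle.exp (x + s))) (f (Circle.exp x)) ^ p := by
    have : 64 / ε = 4 * (16 / ε) := by ring
    rw [this]; linarith
  have h0 : 0 ≤ ∫ s in (-ε)..ε, dist (f (Circle.exp (x + s))) (f (Circle.exp x)) ^ p :=
    intervalIntegral.integral_nonneg (by linarith) fun s _ => by positivity
  have hle : ENNReal.ofReal (∫ s in (-ε)..ε,
      dist (f (Circle.exp (x + s))) (f (Circle.exp x)) ^ p) ≤ ∫⁻ s in Set.Ioc (-ε) ε,
      ENNReal.ofReal (dist (f (Circle.exp (x + s))) (f (Circle.exp x)) ^ p) := by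
    rw [intervalIntegral.integral_of_le (by linarith)]
    rw [intervalIntegral.integral_of_le (by linarith)] at h0
    rw [← Real.enorm_of_nonneg h0]
    refine (enorm_integral_le_lintegral_enorm _).trans (le_of_eq (lintegral_congr fun s => ?_))
    exact Real.enorm_of_nonneg (by positivity)
  calc (1 : ENNReal) = ENNReal.ofReal 1 := by simp
    _ ≤ _ := ENNReal.ofReal_le_ofReal hI
    _ = _ := ENNReal.ofReal_mul (by positivity)
    _ ≤ _ := by unfold localOscillation; gcongr

theorem lintegral_localOscillation_le (hp : 1 ≤ p) (hf : Measurable f) {ε : ℝ} (hε : 0 < ε) :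
    ∫⁻ x in Set.Ioc (-Real.pi) Real.pi, localOscillation p f ε x ≤
      ENNReal.ofReal (64 * ε) *
        ∫⁻ t in Set.Ioc (-ε) ε, energyDensity p (fun t => f (Circle.exp t)) t := by
  have hFm : Measurable fun t => f (Circle.exp t) := hf.comp Circle.exp.continuous.measurable
  unfold localOscillation
  rw [lintegral_const_mul' _ _ ENNReal.ofReal_ne_top,
    ← lintegral_shiftEnergy_eq (F := fun t => f (Circle.exp t)) hFm]
  calc _ ≤ ENNReal.ofReal (64 / ε) * ∫⁻ t in Set.Ioc (-ε) ε,
        ENNReal.ofReal (ε ^ 2) * energyDensity p (fun t => f (Circle.exp t)) t := by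
        gcongr ENNReal.ofReal (64 / ε) * ?_
        refine setLIntegral_mono' measurableSet_Ioc fun t ht => ?_
        exact shiftEnergy_le_energyDensity hp (abs_le.2 ⟨ht.1.le, ht.2⟩)
    _ = _ := by
        rw [lintegral_const_mul' _ _ ENNReal.ofReal_ne_top, ← mul_assoc,
          ← ENNReal.ofReal_mul (by positivity)]
        congr 2
        field_simp

/-- The arc means at scale `ε` are close to `f` at the `n` equidistant points starting at
`exp x`. -/
def IsGoodSample (f : Circle → Circle) (ε : ℝ) (n : ℕ) (x : ℝ) : Prop :=
  ∀ i : ℕ, ‖arcMean f ε (Circle.exp (x + i * (2 * Real.pi / n))) -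
    f (Circle.exp (x + i * (2 * Real.pi / n)))‖ ≤ 1 / 2

/-- A bad sample point has local oscillation at least `1`; Markov's inequality is applied to the sum
over the `n` points. The constant is `64 n ε` with `n ε ≤ 80π`. -/
theorem measure_not_isGoodSample_le (hp : 1 ≤ p) (hp2 : p ≤ 2) (hf : Measurable f) {ε : ℝ}
    (hε : 0 < ε) {n : ℕ} (hn : n ≠ 0) (hnε : ε ≤ 40 * (2 * Real.pi / n)) :
    volume.restrict (Set.Ioc (-Real.pi) Real.pi) {x | ¬ IsGoodSample f ε n x} ≤
      ENNReal.ofReal (5120 * Real.pi) *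
        ∫⁻ t in Set.Ioc (-ε) ε, energyDensity p (fun t => f (Circle.exp t)) t := by
  have hn' : (0 : ℝ) < n := by exact_mod_cast Nat.pos_of_ne_zero hn
  have hpi := Real.pi_pos
  have hFm : Measurable fun t => f (Circle.exp t) := hf.comp Circle.exp.continuous.measurable
  set r := 2 * Real.pi / n with hr
  have hper : Function.Periodic (localOscillation p f ε) (2 * Real.pi) := by
    intro x
    unfold localOscillation
    simp only [show ∀ s, x + 2 * Real.pi + s = x + s + 2 * Real.pi from fun s => by ring,
      Circle.exp_add_two_pi]
  have hmeas : Measurable (localOscillation p f ε) :=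
    ((measurable_dist_shift p hFm).ennreal_ofReal.lintegral_prod_right').const_mul _
  have hsub : {x | ¬ IsGoodSample f ε n x} ⊆
      {x | 1 ≤ ∑ i ∈ Finset.range n, localOscillation p f ε (x + i * r)} := by
    intro x hx
    simp only [Set.mem_ofPred_eq, IsGoodSample, not_forall, not_le] at hx ⊢
    obtain ⟨i, hi⟩ := hx
    -- `IsGoodSample` ranges over all indices, but the sample points repeat with period `n`.
    have e : Circle.exp (x + i * r) = Circle.exp (x + (i % n : ℕ) * r) := by
      refine Circle.exp_eq_exp.2 ⟨((i / n : ℕ) : ℤ), ?_⟩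
      have h1 : (i : ℝ) = (i % n : ℕ) + n * (i / n : ℕ) := by
        exact_mod_cast (Nat.mod_add_div i n).symm
      rw [h1, hr, Int.cast_natCast]
      field_simp
      ring
    rw [← hr, e] at hi
    refine (one_le_localOscillation hp hp2 hf hε hi).trans ?_
    exact Finset.single_le_sum (f := fun i : ℕ => localOscillation p f ε (x + i * r))
      (fun _ _ => zero_le) (Finset.mem_range.2 (Nat.mod_lt _ (Nat.pos_of_ne_zero hn)))
  calc _ ≤ volume.restrict (Set.Ioc (-Real.pi) Real.pi)
        {x | 1 ≤ ∑ i ∈ Finset.range n, localOscillation p f ε (x + i * r)} := measure_mono hsub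
    _ ≤ ∫⁻ x in Set.Ioc (-Real.pi) Real.pi,
          ∑ i ∈ Finset.range n, localOscillation p f ε (x + i * r) := by
        have := mul_meas_ge_le_lintegral (μ := volume.restrict (Set.Ioc (-Real.pi) Real.pi))
          (f := fun x => ∑ i ∈ Finset.range n, localOscillation p f ε (x + i * r))
          (Finset.measurable_sum _ fun i _ => hmeas.comp (measurable_id.add_const _)) 1
        simpa using this
    _ = n * ∫⁻ x in Set.Ioc (-Real.pi) Real.pi, localOscillation p f ε x :=
        lintegral_sum_comp_add hper hmeas n (fun i => i * r)
    _ ≤ n * (ENNReal.ofReal (64 * ε) * _) := by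
        gcongr
        exact lintegral_localOscillation_le hp hf hε
    _ ≤ _ := by
        rw [← mul_assoc, ← ENNReal.ofReal_natCast, ← ENNReal.ofReal_mul (by positivity)]
        refine mul_le_mul_left (ENNReal.ofReal_le_ofReal ?_) _
        have : (n : ℝ) * ε ≤ 80 * Real.pi := by
          calc (n : ℝ) * ε ≤ n * (40 * r) := by gcongr
            _ = 80 * Real.pi := by rw [hr]; field_simp; norm_num
        linarith

/-- The open unit disc about `c` lies in the open half-plane of direction `c`. -/
theorem re_div_pos {h : ℂ} {g c : Circle} (hh : ‖h - c‖ < 1) (h0 : h ≠ 0)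
    (hg : (g : ℂ) = h / (‖h‖ : ℂ)) : 0 < ((g / c : Circle) : ℂ).re := by
  have hn : 0 < ‖h‖ := norm_pos_iff.2 h0
  have e : ((g / c : Circle) : ℂ) = ((‖h‖⁻¹ : ℝ) : ℂ) * (1 + (h - c) / c) := by
    have hc := Circle.coe_ne_zero c
    rw [Circle.coe_div, hg]
    have : (‖h‖ : ℂ) ≠ 0 := by exact_mod_cast hn.ne'
    push_cast
    field_simp
    ring
  rw [e, Complex.re_ofReal_mul]
  have h1 : ‖(h - c) / (c : ℂ)‖ < 1 := by
    rwa [norm_div, Circle.norm_coe, div_one]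
  have h2 := (abs_le.1 (Complex.abs_re_le_norm ((h - c) / (c : ℂ)))).1
  have : 0 < (1 + (h - c) / (c : ℂ)).re := by
    rw [Complex.add_re, Complex.one_re]; linarith
  positivity

theorem IsGoodSample.norm_sub_lt_one (hf : Measurable f) {ε : ℝ} (hε : 0 < ε) {n : ℕ} {x : ℝ}
    (hx : IsGoodSample f ε n x) (hnε : 2 * Real.pi / n ≤ ε / 10) (i : ℕ) {t : ℝ}
    (ht : t ∈ Set.Icc (x + i * (2 * Real.pi / n)) (x + (i + 1 : ℕ) * (2 * Real.pi / n))) :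
    ‖arcMean f ε (Circle.exp t) - f (Circle.exp (x + i * (2 * Real.pi / n)))‖ < 1 := by
  set r := 2 * Real.pi / n with hr
  have h1 := norm_arcMean_sub_le hf hε t (x + i * r)
  have h2 := hx i
  have h3 : |t - (x + i * r)| / ε ≤ 1 / 10 := by
    rw [div_le_iff₀ hε, abs_le]
    have := ht.1
    have := ht.2
    push_cast at this
    constructor <;> linarith
  have := norm_sub_le_norm_sub_add_norm_sub (arcMean f ε (Circle.exp t))
    (arcMean f ε (Circle.exp (x + i * r))) (f (Circle.exp (x + i * r)) : ℂ)
  linarith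

/-- Every point of the circle lies in some sampling interval, where the mean is at distance less
than `1` from a unit vector. -/
theorem IsGoodSample.arcMean_ne_zero (hf : Measurable f) {ε : ℝ} (hε : 0 < ε) {n : ℕ} (hn : n ≠ 0)
    {x : ℝ} (hx : IsGoodSample f ε n x) (hnε : 2 * Real.pi / n ≤ ε / 10) (y : Circle) :
    arcMean f ε y ≠ 0 := by
  have hn' : (0 : ℝ) < n := by exact_mod_cast Nat.pos_of_ne_zero hn
  have hpi := Real.pi_pos
  have hr0 : 0 < 2 * Real.pi / n := by positivity
  obtain ⟨t, ⟨hxt, -⟩, hty⟩ : ∃ t ∈ Set.Ico x (x + 2 * Real.pi), Circle.exp y.val.arg = Circle.exp t :=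
    Circle.periodic_exp.exists_mem_Ico Real.two_pi_pos (Complex.arg y) x
  rw [Circle.exp_arg] at hty
  intro h0
  have h1 : 0 ≤ (t - x) / (2 * Real.pi / n) := div_nonneg (by linarith) hr0.le
  have h2 := Nat.floor_le h1
  have h3 := (Nat.lt_floor_add_one ((t - x) / (2 * Real.pi / n))).le
  rw [le_div_iff₀ hr0] at h2
  rw [div_le_iff₀ hr0] at h3
  have := hx.norm_sub_lt_one hf hε hnε ⌊(t - x) / (2 * Real.pi / n)⌋₊ (t := t)
    ⟨by linarith, by push_cast; linarith⟩
  rw [← hty, h0, zero_sub, norm_neg, Circle.norm_coe] at this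
  exact lt_irrefl _ this

theorem IsGoodSample.discreteTurn_eq (hf : Measurable f) {ε : ℝ} (hε : 0 < ε) {n : ℕ} (hn : n ≠ 0)
    {x : ℝ} (hx : IsGoodSample f ε n x) (hnε : 2 * Real.pi / n ≤ ε / 10) {g : Circle → Circle}
    (hg : ∀ x, arcMean f ε x ≠ 0 ∧ (g x : ℂ) = arcMean f ε x / (‖arcMean f ε x‖ : ℂ)) {d : ℤ}
    (hd : HasWindingNumber g d) :
    discreteTurn (fun t => f (Circle.exp t)) n x = 2 * Real.pi * d := by
  obtain ⟨θ, hθ, hgθ, hθd⟩ := hd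
  have hper : ∀ u : Circle → Circle,
      Function.Periodic (fun t => u (Circle.exp t)) (2 * Real.pi) := fun u t => by
    simp only [Circle.exp_add_two_pi]
  rw [← lift_period_eq_discreteTurn (F := fun t => f (Circle.exp t)) hθ (hper f) (hper g) hgθ hn x,
    lift_period_eq hθ (hper g) hgθ, hθd]
  intro i t ht
  exact re_div_pos (hx.norm_sub_lt_one hf hε hnε i ht) (hg _).1 (hg _).2

theorem exists_hasWindingNumber (hf : Measurable f) {ε : ℝ} (hε : 0 < ε)
    (h0 : ∀ y, arcMean f ε y ≠ 0) :
    ∃ g : Circle → Circle, ∃ d : ℤ,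
      (∀ x, arcMean f ε x ≠ 0 ∧ (g x : ℂ) = arcMean f ε x / (‖arcMean f ε x‖ : ℂ)) ∧
        HasWindingNumber g d := by
  have hex : ∀ x, ∃ z : Circle, (z : ℂ) = arcMean f ε x / (‖arcMean f ε x‖ : ℂ) := fun x =>
    ⟨⟨arcMean f ε x / (‖arcMean f ε x‖ : ℂ), 
      mem_sphere_zero_iff_norm.2 (by simp [h0 x])⟩, rfl⟩
  choose g hg using hex
  have hper : Function.Periodic (fun t => g (Circle.exp t)) (2 * Real.pi) := fun t => by
    simp only [Circle.exp_add_two_pi]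
  have hgc : Continuous fun t => g (Circle.exp t) := by
    refine (Topology.IsInducing.continuous_iff (g := fun z : Circle => (z : ℂ)) ⟨rfl⟩).2 ?_
    have hc := continuous_arcMean_exp hf hε
    simp only [Function.comp_def, hg]
    refine hc.div (Complex.continuous_ofReal.comp hc.norm) fun t => ?_
    simpa using h0 (Circle.exp t)
  obtain ⟨θ, hθ, hgθ⟩ := exists_lift hgc
  obtain ⟨d, hd⟩ := exists_lift_period_eq hper hgθ
  exact ⟨g, d, fun x => ⟨h0 x, hg x⟩, θ, hθ, hgθ, hd⟩

end

/-! ### Existence of the VMO degree. -/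

section
variable {p : ℝ} {f : Circle → Circle}

theorem exists_lintegral_energyDensity_le
    (hfin : ∫⁻ t in Set.Ioc (-Real.pi) Real.pi,
      energyDensity p (fun t => f (Circle.exp t)) t ≠ ⊤) {η : ENNReal} (hη : 0 < η) :
    ∃ ε₀ > 0, ε₀ < Real.pi ∧ ∀ ε, 0 < ε → ε < ε₀ →
      ∫⁻ t in Set.Ioc (-ε) ε, energyDensity p (fun t => f (Circle.exp t)) t ≤ η := by
  have hlim : Tendsto (fun ε : ℝ => volume.restrict (Set.Ioc (-Real.pi) Real.pi) (Set.Ioc (-ε) ε))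
      (𝓝[>] 0) (𝓝 0) := by
    have h1 : Tendsto (fun ε : ℝ => ENNReal.ofReal (ε - -ε)) (𝓝[>] 0) (𝓝 0) := by
      have : Continuous fun ε : ℝ => ENNReal.ofReal (ε - -ε) :=
        ENNReal.continuous_ofReal.comp (continuous_id.sub continuous_id.neg)
      simpa using (this.tendsto 0).mono_left nhdsWithin_le_nhds
    refine tendsto_of_tendsto_of_tendsto_of_le_of_le tendsto_const_nhds h1 (fun _ => zero_le)
      fun ε => ?_
    exact (Measure.restrict_apply_le _ _).trans (by rw [Real.volume_Ioc])
  have h2 := (tendsto_setLIntegral_zero hfin hlim).eventually (ge_mem_nhds hη)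
  obtain ⟨a, ha, h⟩ := (mem_nhdsGT_iff_exists_Ioo_subset).1 h2
  have ha0 : (0 : ℝ) < a := ha
  have hpi := Real.pi_pos
  refine ⟨min a (Real.pi / 2), by positivity, (min_le_right _ _).trans_lt (by linarith), ?_⟩
  intro ε hε hlt
  have h3 : ∫⁻ t in Set.Ioc (-ε) ε, energyDensity p (fun t => f (Circle.exp t)) t
      ∂(volume.restrict (Set.Ioc (-Real.pi) Real.pi)) ≤ η :=
    h ⟨hε, hlt.trans_le (min_le_left _ _)⟩
  have hεpi : ε ≤ Real.pi := (hlt.trans_le (min_le_right _ _)).le.trans (by linarith)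
  rw [Measure.restrict_restrict measurableSet_Ioc, Set.inter_eq_left.2
    (Set.Ioc_subset_Ioc (by linarith) hεpi)] at h3
  exact h3

theorem exists_pow_near_scale {ε : ℝ} (hε : 0 < ε) (hεpi : ε < Real.pi) :
    ∃ k : ℕ, 2 * Real.pi / (2 ^ k : ℕ) ≤ ε / 10 ∧ ε ≤ 20 * (2 * Real.pi / (2 ^ k : ℕ)) := by
  have hpi := Real.pi_pos
  obtain ⟨j, h1, h2⟩ := exists_nat_pow_near (x := 20 * Real.pi / ε) (y := 2)
    (by rw [le_div_iff₀ hε]; linarith) (by norm_num)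
  refine ⟨j + 1, ?_, ?_⟩
  · rw [div_lt_iff₀ hε] at h2
    push_cast
    rw [div_le_iff₀ (by positivity)]
    linarith
  · rw [le_div_iff₀ hε] at h1
    push_cast
    rw [mul_div_assoc', le_div_iff₀ (by positivity), pow_succ]
    linarith

theorem volume_period : volume.restrict (Set.Ioc (-Real.pi) Real.pi) Set.univ =
    ENNReal.ofReal (2 * Real.pi) := by
  rw [Measure.restrict_apply_univ, Real.volume_Ioc]
  congr 1
  ring

/-- Two exceptional sets of measure at most `π / 2` cannot cover a period, so both values are taken
at a common point. -/
theorem eq_of_measure_ne_le {u : ℝ → ℝ} {d e : ℤ}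
    (hd : volume.restrict (Set.Ioc (-Real.pi) Real.pi) {x | u x ≠ 2 * Real.pi * d} ≤
      ENNReal.ofReal (Real.pi / 2))
    (he : volume.restrict (Set.Ioc (-Real.pi) Real.pi) {x | u x ≠ 2 * Real.pi * e} ≤
      ENNReal.ofReal (Real.pi / 2)) : d = e := by
  have hpi := Real.pi_pos
  by_contra hne
  have hcover : Set.univ ⊆ {x | u x ≠ 2 * Real.pi * d} ∪ {x | u x ≠ 2 * Real.pi * e} := by
    intro x _
    by_contra hx
    simp only [Set.mem_union, Set.mem_ofPred_eq, not_or, not_not] at hx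
    have := mul_left_cancel₀ Real.two_pi_pos.ne' (hx.1.symm.trans hx.2)
    exact hne (by exact_mod_cast this)
  have h := (measure_mono hcover).trans ((measure_union_le _ _).trans (add_le_add hd he))
  rw [volume_period, ← ENNReal.ofReal_add (by positivity) (by positivity),
    ENNReal.ofReal_le_ofReal_iff (by positivity)] at h
  linarith

/-- At every small scale the normalized arc means have a winding number, which is `1 / 2π` times
the discrete turning of `f` at comparable scales, for most base points. -/
theorem exists_winding_at_scale (hp : 1 ≤ p) (hp2 : p ≤ 2) (hf : Measurable f)
    (hfin : ∫⁻ t in Set.Ioc (-Real.pi) Real.pi,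
      energyDensity p (fun t => f (Circle.exp t)) t ≠ ⊤) :
    ∃ ε₀ > 0, ε₀ < Real.pi ∧ ∀ ε, 0 < ε → ε < ε₀ → ∃ d : ℤ,
      (∃ g : Circle → Circle,
        (∀ x, arcMean f ε x ≠ 0 ∧ (g x : ℂ) = arcMean f ε x / (‖arcMean f ε x‖ : ℂ)) ∧
          HasWindingNumber g d) ∧
      ∀ n : ℕ, n ≠ 0 → 2 * Real.pi / n ≤ ε / 10 → ε ≤ 20 * (2 * Real.pi / n) →
        volume.restrict (Set.Ioc (-Real.pi) Real.pi)
          {x | discreteTurn (fun t => f (Circle.exp t)) n x ≠ 2 * Real.pi * d} ≤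
            ENNReal.ofReal (Real.pi / 2) := by
  have hpi := Real.pi_pos
  obtain ⟨ε₀, hε₀, hε₀pi, hsmall⟩ := exists_lintegral_energyDensity_le hfin
    -- Chosen so that `5120π η = π / 2`.
    (η := ENNReal.ofReal (1 / 10240)) (by simp)
  refine ⟨ε₀, hε₀, hε₀pi, fun ε hε hlt => ?_⟩
  have hbad : ∀ n : ℕ, n ≠ 0 → ε ≤ 20 * (2 * Real.pi / n) →
      volume.restrict (Set.Ioc (-Real.pi) Real.pi) {x | ¬ IsGoodSample f ε n x} ≤
        ENNReal.ofReal (Real.pi / 2) := by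
    intro n hn h20
    have hr : 0 ≤ 2 * Real.pi / n := by positivity
    refine (measure_not_isGoodSample_le hp hp2 hf hε hn (by linarith)).trans ?_
    calc _ ≤ ENNReal.ofReal (5120 * Real.pi) * ENNReal.ofReal (1 / 10240) :=
          mul_le_mul_right (hsmall ε hε hlt) _
      _ = _ := by
          rw [← ENNReal.ofReal_mul (by positivity)]
          congr 1
          ring
  obtain ⟨k, hk1, hk2⟩ := exists_pow_near_scale hε (hlt.trans hε₀pi)
  obtain ⟨x, hx⟩ : ∃ x, IsGoodSample f ε (2 ^ k) x := by
    by_contra hne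
    push Not at hne
    have h := hbad (2 ^ k) (by positivity) hk2
    rw [show {x | ¬ IsGoodSample f ε (2 ^ k) x} = Set.univ from Set.eq_univ_of_forall hne,
      volume_period, ENNReal.ofReal_le_ofReal_iff (by positivity)] at h
    linarith
  obtain ⟨g, d, hg, hgd⟩ := exists_hasWindingNumber hf hε
    (hx.arcMean_ne_zero hf hε (by positivity) hk1)
  refine ⟨d, ⟨g, hg, hgd⟩, fun n hn h10 h20 => ?_⟩
  refine (measure_mono fun y hy hgood => ?_).trans (hbad n hn h20)
  exact hy (hgood.discreteTurn_eq hf hε hn h10 hg hgd)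

theorem exists_hasVMODegree (hp : 1 ≤ p) (hp2 : p ≤ 2) (hf : Measurable f)
    (hfin : ∫⁻ t in Set.Ioc (-Real.pi) Real.pi,
      energyDensity p (fun t => f (Circle.exp t)) t ≠ ⊤) :
    ∃ d : ℤ, HasVMODegree f d ∧ ∃ N : ℕ, ∀ k ≥ N,
      volume.restrict (Set.Ioc (-Real.pi) Real.pi)
        {x | discreteTurn (fun t => f (Circle.exp t)) (2 ^ k) x ≠ 2 * Real.pi * d} ≤
          ENNReal.ofReal (Real.pi / 2) := by
  have hpi := Real.pi_pos
  obtain ⟨ε₀, hε₀, hε₀pi, H⟩ := exists_winding_at_scale hp hp2 hf hfin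
  choose! d hd hturn using H
  let r : ℕ → ℝ := fun k => 2 * Real.pi / (2 ^ k : ℕ)
  have hr0 : ∀ k, 0 < r k := fun k => by positivity
  have hrs : ∀ k, r (k + 1) = r k / 2 := by
    intro k
    simp only [r]
    push_cast
    rw [pow_succ]
    field_simp
  have hanti : Antitone r := antitone_nat_of_succ_le fun k => by
    rw [hrs]; linarith [hr0 k]
  obtain ⟨N, hN⟩ : ∃ N, 10 * r N < ε₀ := by
    obtain ⟨N, hN⟩ := pow_unbounded_of_one_lt (20 * Real.pi / ε₀) (by norm_num : (1 : ℝ) < 2)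
    refine ⟨N, ?_⟩
    rw [div_lt_iff₀ hε₀] at hN
    simp only [r]
    push_cast
    rw [mul_div_assoc', div_lt_iff₀ (by positivity)]
    linarith
  have hlt : ∀ k ≥ N, 10 * r k < ε₀ := fun k hk => by linarith [hanti hk]
  have hself : ∀ k ≥ N, volume.restrict (Set.Ioc (-Real.pi) Real.pi)
      {x | discreteTurn (fun t => f (Circle.exp t)) (2 ^ k) x ≠ 2 * Real.pi * d (10 * r k)} ≤
          ENNReal.ofReal (Real.pi / 2) := fun k hk =>
    hturn (10 * r k) (by linarith [hr0 k]) (hlt k hk) (2 ^ k) (by positivity)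
      (by change r k ≤ _; linarith) (by change _ ≤ 20 * r k; linarith [hr0 k])
  -- `ε = 10 r k` is admissible for `2 ^ k` and, being `20 r (k + 1)`, also for `2 ^ (k + 1)`; this
  -- links neighbouring scales.
  have hconst : ∀ k ≥ N, d (10 * r k) = d (10 * r N) := by
    intro k hk
    induction k, hk using Nat.le_induction with
    | base => rfl
    | succ k hk ih =>
      rw [← ih]
      have hk' := hrs k
      refine eq_of_measure_ne_le (hself (k + 1) (by omega)) ?_
      exact hturn (10 * r k) (by linarith [hr0 k]) (hlt k hk) (2 ^ (k + 1)) (by positivity)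
        (by change r (k + 1) ≤ _; linarith [hr0 k])
        (by change _ ≤ 20 * r (k + 1); linarith [hr0 k])
  refine ⟨d (10 * r N), ?_, N, fun k hk => hconst k hk ▸ hself k hk⟩
  have hmem : Set.Ioo (0 : ℝ) (10 * r N) ∈ 𝓝[>] (0 : ℝ) :=
    Ioo_mem_nhdsGT (by linarith [hr0 N])
  refine Filter.mem_of_superset hmem fun ε hε => ?_
  have hεlt : ε < ε₀ := hε.2.trans hN
  obtain ⟨k, hk1, hk2⟩ := exists_pow_near_scale hε.1 (hεlt.trans hε₀pi)
  have hkN : N ≤ k := by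
    by_contra hlt
    have : r N ≤ r k := hanti (by omega)
    have h1 : r k ≤ ε / 10 := hk1
    linarith [hε.2]
  have e : d ε = d (10 * r N) := by
    rw [← hconst k hkN]
    exact eq_of_measure_ne_le (hturn ε hε.1 hεlt (2 ^ k) (by positivity) hk1 hk2) (hself k hkN)
  change ∃ g : Circle → Circle, _
  rw [← e]
  exact hd ε hε.1 hεlt

/-! ### The degree estimate. -/

/-- Off the exceptional set, hence on measure at least `3π / 2 ≥ π`, the integrand is `2π |d|`. -/
theorem degree_mul_le_lintegral {u : ℝ → ℝ} (hu : Measurable u) {d : ℤ}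
    (hd : volume.restrict (Set.Ioc (-Real.pi) Real.pi) {x | u x ≠ 2 * Real.pi * d} ≤
      ENNReal.ofReal (Real.pi / 2)) :
    ENNReal.ofReal (2 * Real.pi ^ 2 * |(d : ℝ)|) ≤
      ∫⁻ x in Set.Ioc (-Real.pi) Real.pi, ENNReal.ofReal |u x| := by
  have hpi := Real.pi_pos
  have h1 := mul_meas_ge_le_lintegral (μ := volume.restrict (Set.Ioc (-Real.pi) Real.pi))
    hu.abs.ennreal_ofReal (ENNReal.ofReal (2 * Real.pi * |(d : ℝ)|))
  refine le_trans ?_ h1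
  have hcover : Set.univ ⊆
      {x | ENNReal.ofReal (2 * Real.pi * |(d : ℝ)|) ≤ ENNReal.ofReal |u x|} ∪
        {x | u x ≠ 2 * Real.pi * d} := by
    intro x _
    by_cases hx : u x = 2 * Real.pi * d
    · left
      change ENNReal.ofReal _ ≤ ENNReal.ofReal _
      rw [hx, abs_mul, abs_of_pos Real.two_pi_pos]
    · exact Or.inr hx
  have h2 := (measure_mono hcover).trans ((measure_union_le _ _).trans (add_le_add_right hd _))
  rw [volume_period, ← tsub_le_iff_right, ← ENNReal.ofReal_sub _ (by positivity)] at h2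
  calc ENNReal.ofReal (2 * Real.pi ^ 2 * |(d : ℝ)|)
      = ENNReal.ofReal (2 * Real.pi * |(d : ℝ)|) * ENNReal.ofReal Real.pi := by
        rw [← ENNReal.ofReal_mul (by positivity)]
        congr 1
        ring
    _ ≤ _ := by
        gcongr
        exact (ENNReal.ofReal_le_ofReal (by linarith)).trans h2

theorem degree_bound_of_measurable (hp : 1 < p) (hp2 : p ≤ 2) (hf : Measurable f)
    (hfin : ∫⁻ x, ∫⁻ y, ENNReal.ofReal (dist (f x) (f y) ^ p / dist x y ^ 2)
        ∂arclength ∂arclength ≠ ⊤) :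
    ∃ d : ℤ, HasVMODegree f d ∧ ENNReal.ofReal |(d : ℝ)| ≤ ENNReal.ofReal (48 * (p - 1)) *
      ∫⁻ x, ∫⁻ y, ENNReal.ofReal (dist (f x) (f y) ^ p / dist x y ^ 2)
        ∂arclength ∂arclength := by
  have hpi := Real.pi_pos
  have hFm : Measurable fun t => f (Circle.exp t) := hf.comp Circle.exp.continuous.measurable
  have hF : Function.Periodic (fun t => f (Circle.exp t)) (2 * Real.pi) := fun t => by
    simp only [Circle.exp_add_two_pi]
  have hE := lintegral_energyDensity_le hp.le hf
  obtain ⟨d, hd, N, hN⟩ := exists_hasVMODegree hp.le hp2 hf (ne_top_of_le_ne_top hfin hE)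
  refine ⟨d, hd, ?_⟩
  set E := ∫⁻ x, ∫⁻ y, ENNReal.ofReal (dist (f x) (f y) ^ p / dist x y ^ 2)
    ∂arclength ∂arclength
  have hp0 : 0 < p - 1 := by linarith
  set K := ⌊1 / (p - 1)⌋₊ with hKdef
  have hK1 : (K : ℝ) * (p - 1) ≤ 1 := by
    rw [← le_div_iff₀ hp0]
    exact Nat.floor_le (by positivity)
  have hKone : 1 ≤ K := Nat.one_le_floor_iff _ |>.2 (by rw [le_div_iff₀ hp0]; linarith)
  have hKone' : (1 : ℝ) ≤ K := by exact_mod_cast hKone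
  -- Since `K ≥ 1`, rounding down loses at most a factor `2`; here `p ≤ 2` enters.
  have hK2 : 1 ≤ 2 * K * (p - 1) := by
    have h := Nat.lt_floor_add_one (1 / (p - 1))
    rw [div_lt_iff₀ hp0] at h
    have : ((K : ℝ) + 1) * (p - 1) ≤ 2 * K * (p - 1) := by gcongr; linarith
    linarith
  have hsum := sum_lintegral_discreteTurn_le hp.le hp2 hFm hF hK1 N
  have hlow : K * ENNReal.ofReal (2 * Real.pi ^ 2 * |(d : ℝ)|) ≤
      ENNReal.ofReal (48 * Real.pi ^ 2) * E := by
    calc K * ENNReal.ofReal (2 * Real.pi ^ 2 * |(d : ℝ)|)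
        = ∑ k ∈ Finset.range K, ENNReal.ofReal (2 * Real.pi ^ 2 * |(d : ℝ)|) := by simp
      _ ≤ _ := Finset.sum_le_sum fun k _ =>
          degree_mul_le_lintegral (measurable_discreteTurn hFm _) (hN (N + k) (by omega))
      _ ≤ _ := hsum
      _ ≤ _ := mul_le_mul_right hE _
  have hK0 : (0 : ℝ) < K := by linarith
  calc ENNReal.ofReal |(d : ℝ)|
      = ENNReal.ofReal (1 / (2 * Real.pi ^ 2 * K)) *
          (K * ENNReal.ofReal (2 * Real.pi ^ 2 * |(d : ℝ)|)) := by
        rw [← ENNReal.ofReal_natCast, ← ENNReal.ofReal_mul (by positivity),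
          ← ENNReal.ofReal_mul (by positivity)]
        congr 1
        field_simp
    _ ≤ ENNReal.ofReal (1 / (2 * Real.pi ^ 2 * K)) * (ENNReal.ofReal (48 * Real.pi ^ 2) * E) :=
        mul_le_mul_right hlow _
    _ = ENNReal.ofReal (24 / K) * E := by
        rw [← mul_assoc, ← ENNReal.ofReal_mul (by positivity)]
        congr 2
        field_simp
        norm_num
    _ ≤ ENNReal.ofReal (48 * (p - 1)) * E := by
        refine mul_le_mul_left (ENNReal.ofReal_le_ofReal ?_) _
        rw [div_le_iff₀ hK0]
        linarith

/-! ### Passage from measurable to a.e. measurable maps. -/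

theorem arcMean_congr_ae {f' : Circle → Circle} (h : f =ᵐ[arclength] f') (ε : ℝ) (x : Circle) :
    arcMean f ε x = arcMean f' ε x := by
  have h1 : ∀ᵐ t ∂(volume.restrict (Set.Ioc (-Real.pi) Real.pi)),
      f (Circle.exp t) = f' (Circle.exp t) :=
    ae_of_ae_map Circle.exp.continuous.measurable.aemeasurable h
  have h2 : ∀ᵐ t : ℝ, f (Circle.exp t) = f' (Circle.exp t) := by
    have hdom := isAddFundamentalDomain_Ioc Real.two_pi_pos (-Real.pi)
    rw [show -Real.pi + 2 * Real.pi = Real.pi by ring] at hdom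
    refine hdom.measure_zero_of_invariant _ ?_ ?_
    · rintro ⟨g, hg⟩
      obtain ⟨n, rfl⟩ := AddSubgroup.mem_zmultiples_iff.1 hg
      ext t
      rw [Set.mem_vadd_set_iff_neg_vadd_mem]
      have : Circle.exp (-(n • (2 * Real.pi)) + t) = Circle.exp t := by
        rw [neg_add_eq_sub]
        exact Circle.periodic_exp.sub_zsmul_eq n
      change ¬ (f (Circle.exp (-(n • (2 * Real.pi)) + t)) =
        f' (Circle.exp (-(n • (2 * Real.pi)) + t))) ↔ ¬ (f (Circle.exp t) = f' (Circle.exp t))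
      rw [this]
    · rw [ae_iff, Measure.restrict_apply₀' measurableSet_Ioc.nullMeasurableSet] at h1
      exact h1
  have h3 : ∀ᵐ s : ℝ, f (Circle.exp (Complex.arg x + s)) = f' (Circle.exp (Complex.arg x + s)) :=
    (measurePreserving_add_left volume (Complex.arg x)).quasiMeasurePreserving.ae h2
  unfold arcMean
  congr 1
  refine intervalIntegral.integral_congr_ae ?_
  filter_upwards [h3] with s hs _
  rw [Circle.exp_add, Circle.exp_arg] at hs
  rw [hs]

theorem lintegral_energy_congr_ae {f' : Circle → Circle} (h : f =ᵐ[arclength] f') (p : ℝ) :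
    ∫⁻ x, ∫⁻ y, ENNReal.ofReal (dist (f x) (f y) ^ p / dist x y ^ 2) ∂arclength ∂arclength =
      ∫⁻ x, ∫⁻ y, ENNReal.ofReal (dist (f' x) (f' y) ^ p / dist x y ^ 2)
        ∂arclength ∂arclength := by
  refine lintegral_congr_ae ?_
  filter_upwards [h] with x hx
  refine lintegral_congr_ae ?_
  filter_upwards [h] with y hy
  rw [hx, hy]

end

theorem HasVMODegree.vmoDegree_eq {f : Circle → Circle} {d : ℤ} (hd : HasVMODegree f d) :
    vmoDegree f = d := by
  have h : ∃ d, HasVMODegree f d := ⟨d, hd⟩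
  rw [vmoDegree, dif_pos h]
  exact h.choose_spec.unique hd

theorem theorem1p3 :
    ∃ c : ℝ, ∀ p : ℝ, 1 < p → p ≤ 2 → ∀ f : Circle → Circle, MemFracSobolev (1 / p) p f →
      HasVMODegree f (vmoDegree f) ∧
        ENNReal.ofReal |(vmoDegree f : ℝ)| ≤
          ENNReal.ofReal (c * (p - 1)) *
            ∫⁻ x, ∫⁻ y, ENNReal.ofReal (dist (f x) (f y) ^ p / dist x y ^ 2)
              ∂arclength ∂arclength := by
  refine ⟨48, fun p hp hp2 f hf => ?_⟩
  obtain ⟨hmeas, hfin⟩ := hf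
  have hexp : 1 + 1 / p * p = ((2 : ℕ) : ℝ) := by
    field_simp
    norm_num
  simp only [hexp, Real.rpow_natCast] at hfin
  have hae := hmeas.ae_eq_mk
  rw [lintegral_energy_congr_ae hae] at hfin ⊢
  obtain ⟨d, hd, hbound⟩ := degree_bound_of_measurable hp hp2 hmeas.measurable_mk hfin.ne
  have hfd : HasVMODegree f d := by
    have e : arcMean f = arcMean (hmeas.mk f) :=
      funext fun ε => funext fun x => arcMean_congr_ae hae ε x
    unfold HasVMODegree
    rw [e]
    exact hd
  rw [hfd.vmoDegree_eq]
  exact ⟨hfd, hbound⟩
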